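/- Theorem 1. Let $U=[0,1]^2$ and let $S\subset U$ be a finite point set that contains the origin. A lower-left anchored rectangle packing (LLARP) of $S$ is a set of pairwise interior-disjoint closed axis-parallel rectangles contained in $U$ (segments and single points count as degenerate rectangles of area zero), none of which contains a point of $S$ in its interior, such that each rectangle has a point of $S$ as its lower-left corner and each point of $S$ is the lower-left corner of exactly one rectangle. The area of a packing is the area of the union of its rectangles. The GreedyPacking algorithm starts with $R=\emptyset$ and treats the points of $S$ one by one, a point with larger coordinate sum $x+y$ before a point with smaller coordinate sum, ties being broken arbitrarily. When it treats $p$, it adds to $R$ a rectangle of maximum area (any one, if there are several) among the rectangles in $U$ that have $p$ as their lower-left corner and are interior-disjoint from all rectangles in $R$ and contain no point of $S$ in their interior. At the end it returns $R$. For every such $S$, every such order of its points and every choice of the maximum-area rectangles, GreedyPacking is well defined (a maximum-area rectangle exists in each step), and it returns an LLARP of $S$ of area at least $0.10390$. In particular, every finite $S\subset U$ containing the origin has an LLARP of area at least $0.10390$ (Freedman's problem; the previous bound was $0.09121$). Moreover, the approximation ratio of GreedyPacking, that is, the infimum, over all such $S$, all such orders and all choices of the algorithm, of the area of the returned packing divided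 by the supremum of the areas of all LLARPs of $S$, is at least $0.10390$. -/

import Mathlib

noncomputable section

namespace AnchoredPacking

/-- The unit square `[0,1]²` (the order on `ℝ × ℝ` is the componentwise one). -/
def unitSquare : Set (ℝ × ℝ) := Set.Icc (0, 0) (1, 1)

/-- A closed axis-aligned rectangle, given by its lower-left and its upper-right corner.
Segments and single points are allowed, as degenerate rectangles. -/
structure Rect where
  lowerLeft : ℝ × ℝ
  upperRight : ℝ × ℝ
  le : lowerLeft ≤ upperRight

/-- The set of points `[x₁, x₂] × [y₁, y₂]` of a rectangle. -/
def Rect.carrier (r : Rect) : Set (ℝ × ℝ) := Set.Icc r.lowerLeft r.upperRight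

/-- The (topological) interior of a rectangle; it is empty for degenerate rectangles. -/
def Rect.inner (r : Rect) : Set (ℝ × ℝ) := interior r.carrier

/-- Width times height. -/
def Rect.area (r : Rect) : ℝ :=
  (r.upperRight.1 - r.lowerLeft.1) * (r.upperRight.2 - r.lowerLeft.2)

/-- The area (Lebesgue measure) of the union of a set of rectangles. -/
def totalArea (R : Set Rect) : ℝ := (MeasureTheory.volume (⋃ r ∈ R, r.carrier)).toReal

/-- `R` is a lower-left anchored (empty) rectangle packing of the point set `S`. -/
structure IsLLARP (S : Finset (ℝ × ℝ)) (R : Set Rect) : Prop where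
  /-- the rectangles lie in the unit square -/
  subset_unitSquare : ∀ r ∈ R, r.carrier ⊆ unitSquare
  /-- the rectangles are pairwise interior-disjoint -/
  interior_disjoint : ∀ r ∈ R, ∀ r' ∈ R, r ≠ r' → Disjoint r.inner r'.inner
  /-- each rectangle has a point of `S` as its lower-left corner -/
  anchored : ∀ r ∈ R, r.lowerLeft ∈ S
  /-- no rectangle has a point of `S` in its interior -/
  empty : ∀ r ∈ R, ∀ s ∈ S, s ∉ r.inner
  /-- there is exactly one rectangle for each point of `S` -/
  exists_unique : ∀ p ∈ S, ∃! r : Rect, r ∈ R ∧ r.lowerLeft = p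

/-- `l` lists the points of `S`, each exactly once, in the order in which the algorithm treats
them: a point with a larger coordinate sum comes before one with a smaller coordinate sum.
Ties may be broken in any way. -/
structure IsProcessingOrder (S : Finset (ℝ × ℝ)) (l : List (ℝ × ℝ)) : Prop where
  nodup : l.Nodup
  mem_iff : ∀ p, p ∈ l ↔ p ∈ S
  sorted : l.Pairwise (fun p q => q.1 + q.2 ≤ p.1 + p.2)

/-- `r` may be placed at `p` when the rectangles in `R` have been placed already: it lies in the
unit square, is anchored at `p`, and is interior-disjoint with the rectangles in `R` and with
the points in `S`. -/
structure IsCandidate (S : Finset (ℝ × ℝ)) (R : Set Rect) (p : ℝ × ℝ) (r : Rect) : Prop where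
  lowerLeft_eq : r.lowerLeft = p
  subset_unitSquare : r.carrier ⊆ unitSquare
  interior_disjoint : ∀ r' ∈ R, Disjoint r.inner r'.inner
  empty : ∀ s ∈ S, s ∉ r.inner

/-- `r` is a candidate of maximum area. -/
def IsGreedyChoice (S : Finset (ℝ × ℝ)) (R : Set Rect) (p : ℝ × ℝ) (r : Rect) : Prop :=
  IsCandidate S R p r ∧ ∀ r' : Rect, IsCandidate S R p r' → r'.area ≤ r.area

/-- `GreedyRun S l R`: treating the points in the list `l` from first to last, GreedyPacking on
the point set `S` can have produced the set of rectangles `R`. The run starts with no rectangle,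
and each step adds a maximum-area candidate (any one of them, if there are several). -/
inductive GreedyRun (S : Finset (ℝ × ℝ)) : List (ℝ × ℝ) → Set Rect → Prop
  | nil : GreedyRun S [] ∅
  | step {l : List (ℝ × ℝ)} {R : Set Rect} {p : ℝ × ℝ} {r : Rect} :
      GreedyRun S l R → IsGreedyChoice S R p r → GreedyRun S (l ++ [p]) (insert r R)

/-- The instances of the problem: finite subsets of the unit square that contain the origin. -/
def IsInstance (S : Finset (ℝ × ℝ)) : Prop :=
  (∀ p ∈ S, p ∈ unitSquare) ∧ ((0, 0) : ℝ × ℝ) ∈ S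

/-- The optimum: the supremum of the areas of the lower-left anchored rectangle packings. -/
def optimalArea (S : Finset (ℝ × ℝ)) : ℝ :=
  sSup {A : ℝ | ∃ R : Set Rect, IsLLARP S R ∧ A = totalArea R}

/-- The approximation ratio of GreedyPacking: the worst case, over all instances, all admissible
orders and all choices of maximum-area rectangles, of the ratio of the area of the output to the
optimum. -/
def greedyApproximationRatio : ℝ :=
  sInf {ρ : ℝ | ∃ (S : Finset (ℝ × ℝ)) (l : List (ℝ × ℝ)) (R : Set Rect),
    IsInstance S ∧ IsProcessingOrder S l ∧ GreedyRun S l R ∧ ρ = totalArea R / optimalArea S}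

end AnchoredPacking

end

/-!
The *tile* of an anchor `p` consists of the points of the unit square that dominate `p` but no
anchor treated earlier. The tiles partition the square, and every rectangle anchored at `p` inside
the tile of `p` is a candidate when the algorithm treats `p` (`GreedyRun.exists_assignment`).
So the area `r` that the algorithm places at `p` is at least that of any such rectangle, and it
suffices to show that rectangles of maximum area in the tiles have a large total area
(`le_sum_of_forall_mem_tile`).

A tile lies, relative to its anchor, below the hyperbola `x * y = r`. Hence it can be much larger
than `r` only if it has a width `a` and a height `b` such that `a * b` exceeds `r` by a factor
exponential in the ratio of the tile's area to `r`. The widths and heights used here are effective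
ones, at most half of the actual ones (`IsReach`); for them the precise form is
`area ≤ a * b / 128 + r * (2 + 9 * log 2)` (`volume_tile_le`). Summing over the tiles, it remains to
bound the sum of the products `a * b`.

This is done by charging. To an anchor with `b ≤ a` a parallelogram of area `a ^ 2 / 2` below the
bottom edge of its tile is assigned, its *pocket*. No earlier anchor cuts the bottom edge, while
anchors are treated by decreasing coordinate sums; this forces pockets of comparable anchors to be
disjoint (`IsAnchorSequence.lt_of_mem_pocket`), and anchors whose pockets share a point form a
descending chain in which each tile is lower than the vertical gap to the next anchor. With weights
`b / a` the total weight of the pockets at each point is at most `2` (`sum_ratio_le_two`), and so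
`∑ a * b ≤ 6` (`sum_mul_le_six`). The anchors with `a ≤ b` are treated in the same way with the
coordinates swapped.
-/

open MeasureTheory

namespace AnchoredPacking

/-! ### Area under a hyperbola -/

/-- The points `(x, y)` of the box `[0, a] × [0, b]` with `x * y ≤ r`. -/
def hyperbolicRegion (a b r : ℝ) : Set (ℝ × ℝ) :=
  {q | 0 ≤ q.1 ∧ q.1 ≤ a ∧ 0 ≤ q.2 ∧ q.2 ≤ b ∧ q.1 * q.2 ≤ r}

/-- The part of the region to the left of `x = a / K` lies in a box of area `a * b / K`, and the
integral of `r / x` from `a / K` to `a` bounds the rest. -/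
lemma volume_hyperbolicRegion_le {a b r K : ℝ} (ha : 0 ≤ a) (hb : 0 ≤ b) (hr : 0 ≤ r)
    (hK : 1 ≤ K) :
    volume (hyperbolicRegion a b r) ≤ ENNReal.ofReal (a * b / K + r * Real.log K) := by
  have hK0 : 0 < K := by linarith
  rcases ha.eq_or_lt with rfl | ha
  · have : hyperbolicRegion 0 b r ⊆ Set.Icc 0 0 ×ˢ Set.Icc 0 b := by
      rintro q ⟨h1, h2, h3, h4, -⟩
      exact ⟨⟨h1, h2⟩, h3, h4⟩
    refine (measure_mono this).trans ?_
    rw [Measure.volume_eq_prod, Measure.prod_prod]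
    simp
  have hx0 : 0 < a / K := by positivity
  have hx0a : a / K ≤ a := div_le_self ha.le hK
  set T : Set (ℝ × ℝ) := {q | q.1 ∈ Set.Icc (a / K) a ∧ 0 ≤ q.2 ∧ q.1 * q.2 ≤ r} with hT
  have hTm : MeasurableSet T := by
    have : IsClosed T := by
      simp only [hT, Set.mem_Icc]
      have h1 : IsClosed {q : ℝ × ℝ | a / K ≤ q.1} := isClosed_le (by fun_prop) (by fun_prop)
      have h2 : IsClosed {q : ℝ × ℝ | q.1 ≤ a} := isClosed_le (by fun_prop) (by fun_prop)
      have h3 : IsClosed {q : ℝ × ℝ | 0 ≤ q.2} := isClosed_le (by fun_prop) (by fun_prop)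
      have h4 : IsClosed {q : ℝ × ℝ | q.1 * q.2 ≤ r} := isClosed_le (by fun_prop) (by fun_prop)
      exact (h1.inter h2).inter (h3.inter h4)
    exact this.measurableSet
  have hsub : hyperbolicRegion a b r ⊆ (Set.Icc 0 (a / K) ×ˢ Set.Icc 0 b) ∪ T := by
    rintro q ⟨h1, h2, h3, h4, h5⟩
    rcases le_total q.1 (a / K) with h | h
    · exact Or.inl ⟨⟨h1, h⟩, h3, h4⟩
    · exact Or.inr ⟨⟨h, h2⟩, h3, h5⟩
  have hbox : volume (Set.Icc 0 (a / K) ×ˢ Set.Icc 0 b) = ENNReal.ofReal (a * b / K) := by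
    rw [Measure.volume_eq_prod, Measure.prod_prod, Real.volume_Icc, Real.volume_Icc,
      ← ENNReal.ofReal_mul (by linarith)]
    congr 1; ring
  have hint : IntervalIntegrable (fun x : ℝ => r * x⁻¹) volume (a / K) a := by
    apply IntervalIntegrable.const_mul
    apply intervalIntegral.intervalIntegrable_inv _ continuousOn_id
    intro x hx
    rw [Set.uIcc_of_le hx0a] at hx
    exact (hx0.trans_le hx.1).ne'
  have hTv : volume T ≤ ENNReal.ofReal (r * Real.log K) := by
    rw [Measure.volume_eq_prod, Measure.prod_apply hTm]
    calc ∫⁻ x, volume (Prod.mk x ⁻¹' T)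
        ≤ ∫⁻ x, (Set.Icc (a / K) a).indicator (fun x => ENNReal.ofReal (r * x⁻¹)) x := by
          refine lintegral_mono fun x => ?_
          by_cases hx : x ∈ Set.Icc (a / K) a
          · rw [Set.indicator_of_mem hx]
            have hxp : 0 < x := hx0.trans_le hx.1
            have : Prod.mk x ⁻¹' T ⊆ Set.Icc 0 (r * x⁻¹) := by
              rintro y ⟨-, h2, h3⟩
              refine ⟨h2, ?_⟩
              rw [← div_eq_mul_inv, le_div_iff₀ hxp]
              simpa [mul_comm] using h3
            refine (measure_mono this).trans ?_
            rw [Real.volume_Icc, sub_zero]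
          · have : Prod.mk x ⁻¹' T = ∅ := by
              ext y; simp only [hT, Set.mem_preimage, Set.mem_ofPred_eq, Set.mem_empty_iff_false,
                iff_false]
              exact fun h => hx h.1
            rw [this]; simp
      _ = ENNReal.ofReal (r * Real.log K) := by
          rw [lintegral_indicator measurableSet_Icc, ← restrict_Ioc_eq_restrict_Icc,
            ← ofReal_integral_eq_lintegral_ofReal, ← intervalIntegral.integral_of_le hx0a,
            intervalIntegral.integral_const_mul, integral_inv_of_pos hx0 ha]
          · congr 3; field_simp
          · exact (intervalIntegrable_iff_integrableOn_Ioc_of_le hx0a).1 hint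
          · refine (ae_restrict_iff' measurableSet_Ioc).2 (Filter.Eventually.of_forall fun x hx => ?_)
            have := hx0.trans hx.1
            simp only [Pi.zero_apply]; positivity
  calc volume (hyperbolicRegion a b r) ≤ _ := measure_mono hsub
    _ ≤ _ := measure_union_le _ _
    _ ≤ ENNReal.ofReal (a * b / K) + ENNReal.ofReal (r * Real.log K) := by
        rw [hbox]; gcongr
    _ = _ := by
        rw [← ENNReal.ofReal_add (by positivity) (mul_nonneg hr (Real.log_nonneg hK))]

lemma volume_translate (p : ℝ × ℝ) (A : Set (ℝ × ℝ)) :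
    volume {q | q - p ∈ A} = volume A := by
  simp_rw [sub_eq_add_neg]
  exact measure_preimage_add_right volume (-p) A

/-! ### Tiles and their reaches -/

/-- The setting of the area estimate: distinct anchors in the unit square, indexed in the order in
which they are treated, so that coordinate sums decrease weakly along the index. -/
structure IsAnchorSequence {ι : Type*} [LinearOrder ι] (s : ι → ℝ × ℝ) : Prop where
  injective : Function.Injective s
  mem : ∀ i, s i ∈ unitSquare
  sum_le : ∀ i j, i < j → (s j).1 + (s j).2 ≤ (s i).1 + (s i).2

/-- The tile of the anchor `s i`: the points of the unit square that dominate `s i` and no anchor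
treated before it. The tiles of all anchors are disjoint and form staircase polygons. -/
def tile {ι : Type*} [LinearOrder ι] (s : ι → ℝ × ℝ) (i : ι) : Set (ℝ × ℝ) :=
  {q | q ∈ unitSquare ∧ s i ≤ q ∧ ∀ j < i, ¬ s j ≤ q}

/-- `w` and `a` are a width and an effective width of the tile of `s i`.

The width `w` is the length of the bottom edge of the tile: the distance from `s i` to the first
obstacle on its right, an earlier anchor that is not above `s i` or the side of the unit square.
The effective width `a ≤ w / 2` is the horizontal offset of the lowest earlier anchor that meets
the left half of that edge's vertical strip (`0` if it is not to the right of `s i`, or if there is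
none). The part of the tile beyond `a` is thus no higher over the left half than over its middle.

The statements about the height of the tile are obtained by applying this to the anchors with
their coordinates swapped. -/
structure IsReach {ι : Type*} [LinearOrder ι] (s : ι → ℝ × ℝ) (i : ι) (w a : ℝ) : Prop where
  nonneg : 0 ≤ a
  two_mul_le : 2 * a ≤ w
  le_one : (s i).1 + w ≤ 1
  le_of_lt : ∀ j < i, (s j).2 ≤ (s i).2 → (s i).1 + w ≤ (s j).1
  le_of_mem : ∀ q ∈ tile s i, q.1 ≤ (s i).1 + w
  /-- a point of the tile beyond `a` can be slid horizontally to the middle of the width -/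
  half_mem : ∀ q ∈ tile s i, (s i).1 + a ≤ q.1 → ((s i).1 + w / 2, q.2) ∈ tile s i
  /-- a positive effective width is caused by an anchor in the closed quadrant of `s i`, the lowest
  one among those that are at most `w / 2` to the right of `s i` -/
  notch : 0 < a → ∃ k < i, (s k).1 = (s i).1 + a ∧ (s i).2 ≤ (s k).2 ∧
    ∀ j < i, (s j).1 ≤ (s i).1 + w / 2 → (s k).2 ≤ (s j).2

variable {ι : Type*} [LinearOrder ι] {s : ι → ℝ × ℝ}

lemma mem_unitSquare {q : ℝ × ℝ} :
    q ∈ unitSquare ↔ 0 ≤ q.1 ∧ 0 ≤ q.2 ∧ q.1 ≤ 1 ∧ q.2 ≤ 1 := by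
  simp only [unitSquare, Set.mem_Icc, Prod.le_def]; tauto

lemma volume_unitSquare : volume unitSquare = 1 := by
  rw [unitSquare, ← Set.Icc_prod_Icc, Measure.volume_eq_prod, Measure.prod_prod]
  simp

lemma IsAnchorSequence.swap (hs : IsAnchorSequence s) :
    IsAnchorSequence (fun i => (s i).swap) where
  injective := fun i j h => hs.injective (Prod.swap_injective h)
  mem := fun i => by
    have := mem_unitSquare.1 (hs.mem i)
    rw [mem_unitSquare]
    simpa using ⟨this.2.1, this.1, this.2.2.2, this.2.2.1⟩
  sum_le := fun i j h => by
    have := hs.sum_le i j h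
    simp only [Prod.fst_swap, Prod.snd_swap]; linarith

lemma swap_mem_tile_swap {i : ι} {q : ℝ × ℝ} :
    q.swap ∈ tile (fun i => (s i).swap) i ↔ q ∈ tile s i := by
  simp only [tile, Set.mem_ofPred_eq, mem_unitSquare, Prod.le_def, Prod.fst_swap, Prod.snd_swap]
  constructor
  · rintro ⟨h1, h2, h3⟩
    exact ⟨by tauto, h2.symm, fun j hj h => h3 j hj h.symm⟩
  · rintro ⟨h1, h2, h3⟩
    exact ⟨by tauto, h2.symm, fun j hj h => h3 j hj h.symm⟩

lemma IsAnchorSequence.exists_isReach [Fintype ι] (hs : IsAnchorSequence s) (i : ι) :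
    ∃ w a, IsReach s i w a := by
  classical
  obtain ⟨-, -, h1, -⟩ := mem_unitSquare.1 (hs.mem i)
  let F : Finset ℝ := insert 1
    ((Finset.univ.filter fun j => j < i ∧ (s j).2 ≤ (s i).2).image fun j => (s j).1)
  have hF : F.Nonempty := Finset.insert_nonempty _ _
  set w := F.min' hF - (s i).1 with hw
  have hw1 : (s i).1 + w ≤ 1 := by
    have := F.min'_le 1 (Finset.mem_insert_self _ _)
    linarith
  have hwj : ∀ j < i, (s j).2 ≤ (s i).2 → (s i).1 + w ≤ (s j).1 := by
    intro j hj hji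
    have := F.min'_le (s j).1 (Finset.mem_insert_of_mem (Finset.mem_image_of_mem _ (by simp [*])))
    linarith
  have hF' : F.min' hF = 1 ∨ ∃ j < i, (s j).2 ≤ (s i).2 ∧ F.min' hF = (s j).1 := by
    have := F.min'_mem hF
    rcases Finset.mem_insert.1 this with h | h
    · exact Or.inl h
    · obtain ⟨j, hj, h⟩ := Finset.mem_image.1 h
      simp only [Finset.mem_filter, Finset.mem_univ, true_and] at hj
      exact Or.inr ⟨j, hj.1, hj.2, h.symm⟩
  have hw0 : 0 ≤ w := by
    rcases hF' with h | ⟨j, hj, hji, h⟩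
    · linarith
    · have := hs.sum_le j i hj
      linarith
  have hwm : ∀ q ∈ tile s i, q.1 ≤ (s i).1 + w := by
    rintro q ⟨hq, hiq, hjq⟩
    rcases hF' with h | ⟨j, hj, hji, h⟩
    · have := (mem_unitSquare.1 hq).2.2.1
      linarith
    · by_contra! hcon
      exact hjq j hj ⟨by linarith, hji.trans hiq.2⟩
  -- The earlier anchors that can cut the tile over the left half of its bottom edge; the lowest of
  -- them determines `a`.
  let X : Finset ι := Finset.univ.filter fun j => j < i ∧ (s j).1 ≤ (s i).1 + w / 2
  have key : ∀ a, 0 ≤ a → (∀ q ∈ tile s i, (s i).1 + a ≤ q.1 → ∀ j ∈ X, ¬ (s j).2 ≤ q.2) →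
      ∀ q ∈ tile s i, (s i).1 + a ≤ q.1 → ((s i).1 + w / 2, q.2) ∈ tile s i := by
    intro a ha hX q hq haq
    obtain ⟨hqU, hiq, hjq⟩ := hq
    have hX' := hX q ⟨hqU, hiq, hjq⟩ haq
    rw [mem_unitSquare] at hqU
    have hi0 := (mem_unitSquare.1 (hs.mem i)).1
    refine ⟨mem_unitSquare.2 ⟨by simp only; linarith, hqU.2.1, by simp only; linarith,
      hqU.2.2.2⟩, ⟨by simp only; linarith, hiq.2⟩, ?_⟩
    intro j hj hle
    exact hX' j (by simpa [X] using ⟨hj, hle.1⟩) hle.2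
  rcases X.eq_empty_or_nonempty with hX | hX
  · exact ⟨w, 0, le_rfl, by linarith, hw1, hwj, hwm,
      key 0 le_rfl (by simp [hX]), fun h => absurd h (lt_irrefl _)⟩
  · obtain ⟨k, hkX, hk⟩ := X.exists_min_image (fun j => (s j).2) hX
    have hkX' : k < i ∧ (s k).1 ≤ (s i).1 + w / 2 := by simpa [X] using hkX
    have hmax : max ((s k).1 - (s i).1) 0 ≤ w / 2 := max_le (by linarith) (by linarith)
    refine ⟨w, max ((s k).1 - (s i).1) 0, le_max_right _ _, by linarith, hw1, hwj, hwm,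
      key _ (le_max_right _ _) ?_, ?_⟩
    · intro q hq haq j hj hjq
      refine hq.2.2 k hkX'.1 ⟨?_, (hk j hj).trans hjq⟩
      have := le_max_left ((s k).1 - (s i).1) 0
      linarith
    · intro hpos
      have hpos' : 0 < (s k).1 - (s i).1 := by simpa using hpos
      rw [max_eq_left hpos'.le] at hmax ⊢
      refine ⟨k, hkX'.1, by ring, ?_, fun j hj hjw => hk j (by simpa [X] using ⟨hj, hjw⟩)⟩
      by_contra! hlt
      have := hwj k hkX'.1 hlt.le
      linarith

/-- The part of a tile beyond the effective width is small: a point of it at height `y` slides to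
the middle of the width, so `w / 2 * y ≤ r`, and it lies in a hyperbolic region of a box of area
`2 * r`. -/
lemma volume_tail_le (hs : IsAnchorSequence s) {i : ι} {w a r : ℝ} (h : IsReach s i w a)
    (hr : 0 ≤ r) (hrect : ∀ q ∈ tile s i, (q.1 - (s i).1) * (q.2 - (s i).2) ≤ r) :
    volume {q | q ∈ tile s i ∧ (s i).1 + a ≤ q.1} ≤ ENNReal.ofReal (r * (1 + Real.log 2)) := by
  have hw : 0 ≤ w := by linarith [h.nonneg, h.two_mul_le]
  -- For `w = 0` the tail is a vertical segment, and any bound on its height will do.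
  obtain ⟨b, hb, hwb, hqb⟩ : ∃ b, 0 ≤ b ∧ w * b ≤ 2 * r ∧
      ∀ q ∈ tile s i, (s i).1 + a ≤ q.1 → q.2 - (s i).2 ≤ b := by
    rcases hw.eq_or_lt with rfl | hw
    · refine ⟨1, zero_le_one, by linarith, fun q hq _ => ?_⟩
      have := mem_unitSquare.1 hq.1
      have := mem_unitSquare.1 (hs.mem i)
      linarith
    · refine ⟨2 * r / w, by positivity, by field_simp; rfl, fun q hq haq => ?_⟩
      have := hrect _ (h.half_mem q hq haq)
      rw [le_div_iff₀ hw]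
      simp only at this
      nlinarith
  have hsub : {q | q ∈ tile s i ∧ (s i).1 + a ≤ q.1} ⊆
      {q | q - s i ∈ hyperbolicRegion w b r} := by
    rintro q ⟨hq, haq⟩
    refine ⟨?_, ?_, ?_, hqb q hq haq, hrect q hq⟩
    · simpa using hq.2.1.1
    · have := h.le_of_mem q hq
      simp only [Prod.fst_sub]; linarith
    · simpa using hq.2.1.2
  refine (measure_mono hsub).trans ?_
  rw [volume_translate]
  refine (volume_hyperbolicRegion_le hw hb hr one_le_two).trans (ENNReal.ofReal_le_ofReal ?_)
  linarith

/-- The tile is cut into the box of its effective width and height and the two tails beyond it.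
If no rectangle in the tile is larger than `r`, then the tile can only be much larger than `r` when
that box is larger still. The parameter `128` of the hyperbolic estimate is a power of two for the
sake of its logarithm. -/
lemma volume_tile_le (hs : IsAnchorSequence s) {i : ι} {w a h b r : ℝ} (ha : IsReach s i w a)
    (hb : IsReach (fun i => (s i).swap) i h b)
    (hr : 0 ≤ r) (hrect : ∀ q ∈ tile s i, (q.1 - (s i).1) * (q.2 - (s i).2) ≤ r) :
    volume (tile s i) ≤ ENNReal.ofReal (a * b / 128 + r * (2 + 9 * Real.log 2)) := by
  have hlog : 0 ≤ Real.log 2 := Real.log_nonneg one_le_two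
  have hsub : tile s i ⊆ {q | q - s i ∈ hyperbolicRegion a b r} ∪
      ({q | q ∈ tile s i ∧ (s i).1 + a ≤ q.1} ∪
        Prod.swap ⁻¹' {q | q ∈ tile (fun i => (s i).swap) i ∧ (s i).2 + b ≤ q.1}) := by
    intro q hq
    by_cases h1 : (s i).1 + a ≤ q.1
    · exact Or.inr (Or.inl ⟨hq, h1⟩)
    by_cases h2 : (s i).2 + b ≤ q.2
    · exact Or.inr (Or.inr ⟨swap_mem_tile_swap.2 hq, h2⟩)
    refine Or.inl ⟨?_, ?_, ?_, ?_, hrect q hq⟩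
    · simpa using hq.2.1.1
    · simp only [Prod.fst_sub]; linarith
    · simpa using hq.2.1.2
    · simp only [Prod.snd_sub]; linarith
  have htop : volume (Prod.swap ⁻¹' {q | q ∈ tile (fun i => (s i).swap) i ∧ (s i).2 + b ≤ q.1}) ≤
      ENNReal.ofReal (r * (1 + Real.log 2)) := by
    have hpres : MeasurePreserving (MeasurableEquiv.prodComm : ℝ × ℝ ≃ᵐ ℝ × ℝ) volume volume :=
      Measure.measurePreserving_swap
    refine le_trans (le_of_eq (hpres.measure_preimage_equiv _))
      (volume_tail_le hs.swap hb hr fun q hq => ?_)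
    have := hrect q.swap (swap_mem_tile_swap.1 (by simpa using hq))
    simpa [mul_comm] using this
  have h128 : Real.log 128 = 7 * Real.log 2 := by
    rw [show (128 : ℝ) = 2 ^ 7 by norm_num, Real.log_pow]; norm_num
  calc volume (tile s i)
      ≤ _ := measure_mono hsub
    _ ≤ _ := measure_union_le _ _
    _ ≤ _ := add_le_add le_rfl (measure_union_le _ _)
    _ ≤ ENNReal.ofReal (a * b / 128 + r * Real.log 128) +
        (ENNReal.ofReal (r * (1 + Real.log 2)) + ENNReal.ofReal (r * (1 + Real.log 2))) := by
        gcongr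
        · rw [volume_translate]
          exact volume_hyperbolicRegion_le ha.nonneg hb.nonneg hr (by norm_num)
        · exact volume_tail_le hs ha hr hrect
    _ = _ := by
        have h1 := mul_nonneg ha.nonneg hb.nonneg
        rw [← ENNReal.ofReal_add (by positivity) (by positivity), ← ENNReal.ofReal_add
          (by rw [h128]; positivity) (by positivity), h128]
        congr 1; ring

/-! ### Pockets below wide tiles -/

/-- The pocket of an anchor `p` of effective width `a`: the parallelogram of the points at
horizontal distance `x` to the right of `p` and vertical distance `d` below `p`, where
`a < x < 2 * a` and `(x - a) / 2 < d < x / 2`. -/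
def pocket (p : ℝ × ℝ) (a : ℝ) : Set (ℝ × ℝ) :=
  regionBetween (fun x => p.2 - (x - p.1) / 2) (fun x => p.2 - (x - p.1 - a) / 2)
    (Set.Ioo (p.1 + a) (p.1 + 2 * a))

lemma measurableSet_pocket (p : ℝ × ℝ) (a : ℝ) : MeasurableSet (pocket p a) :=
  measurableSet_regionBetween (by fun_prop) (by fun_prop) measurableSet_Ioo

lemma volume_pocket (p : ℝ × ℝ) {a : ℝ} (ha : 0 ≤ a) :
    volume (pocket p a) = ENNReal.ofReal (a * a / 2) := by
  have h := volume_regionBetween_eq_lintegral (μ := (volume : Measure ℝ))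
    (f := fun x => p.2 - (x - p.1) / 2) (g := fun x => p.2 - (x - p.1 - a) / 2)
    (s := Set.Ioo (p.1 + a) (p.1 + 2 * a)) (by fun_prop) (by fun_prop) measurableSet_Ioo
  rw [pocket, Measure.volume_eq_prod, h]
  have : (fun x : ℝ => ENNReal.ofReal (((fun x => p.2 - (x - p.1 - a) / 2) -
      fun x => p.2 - (x - p.1) / 2) x)) = fun _ => ENNReal.ofReal (a / 2) := by
    funext x; simp only [Pi.sub_apply]; congr 1; ring
  rw [this, lintegral_const, Measure.restrict_apply MeasurableSet.univ, Set.univ_inter,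
    Real.volume_Ioo, ← ENNReal.ofReal_mul (by positivity)]
  congr 1; ring

lemma mem_pocket {p z : ℝ × ℝ} {a : ℝ} :
    z ∈ pocket p a ↔ (p.1 + a < z.1 ∧ z.1 < p.1 + 2 * a) ∧
      p.2 - (z.1 - p.1) / 2 < z.2 ∧ z.2 < p.2 - (z.1 - p.1 - a) / 2 := Iff.rfl

/-- If the pockets of two anchors meet, then the higher anchor is to the left of the lower one and
is treated earlier. In particular, pockets of comparable anchors are disjoint; the slanted lower
bound `(x - a) / 2 < d` in the definition of a pocket is what makes this true. -/
lemma IsAnchorSequence.lt_of_mem_pocket (hs : IsAnchorSequence s) {i j : ι} {w a w' a' : ℝ}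
    (hi : IsReach s i w a) (hj : IsReach s j w' a') (ha : 0 < a) (hij : i ≠ j)
    (hle : (s i).2 ≤ (s j).2) {z : ℝ × ℝ} (hzi : z ∈ pocket (s i) a)
    (hzj : z ∈ pocket (s j) a') :
    (s j).1 ≤ (s i).1 ∧ j < i := by
  obtain ⟨⟨h1, h2⟩, h3, h4⟩ := mem_pocket.1 hzi
  obtain ⟨⟨h1', h2'⟩, h3', h4'⟩ := mem_pocket.1 hzj
  have hwa := hi.two_mul_le
  have hwa' := hj.two_mul_le
  have ha' := hj.nonneg
  have hx : (s j).1 ≤ (s i).1 := by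
    by_contra! hlt
    have hji : j < i := by
      refine lt_of_le_of_ne (not_lt.1 fun h => ?_) hij.symm
      have := hs.sum_le i j h
      linarith
    -- The notch of `s i` would stop the bottom edge of the tile of `s j` before `z`, unless its
    -- coordinate sum is too small; so `s j` is above `s i` by at least as much as it is to the
    -- left of the notch. Hence `z` is too low for the pocket of `s j`.
    have hshift : (s i).1 + a - (s j).1 ≤ (s j).2 - (s i).2 := by
      rcases le_or_gt ((s i).1 + a) (s j).1 with h | h
      · linarith
      · obtain ⟨k, -, hk1, hk2, hk3⟩ := hi.notch ha
        have hkj := hk3 j hji (by linarith)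
        have hjk : j ≤ k := not_lt.1 fun hlt' => by
          have := hj.le_of_lt k hlt' hkj
          linarith
        have hne : j ≠ k := fun h' => by rw [h'] at h; linarith
        have := hs.sum_le j k (lt_of_le_of_ne hjk hne)
        linarith
    linarith
  -- If `s i` came first, it would stop the bottom edge of the tile of `s j` before `z`.
  refine ⟨hx, lt_of_le_of_ne (not_lt.1 fun h => ?_) hij.symm⟩
  have := hj.le_of_lt i h hle
  linarith

/-- If `g i` is at most the gap between `y i` and every other value of `y` above it, then the sum
of `g` telescopes. -/
lemma sum_erase_le_of_gap {ι : Type*} [DecidableEq ι] (y g : ι → ℝ) (c : ℝ) (P : Finset ι) :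
    ∀ m ∈ P, (∀ i ∈ P, y i ≤ y m) → (∀ i ∈ P, c ≤ y i) →
      (∀ i ∈ P, ∀ j ∈ P, i ≠ j → y i ≤ y j → g i ≤ y j - y i) →
      ∑ i ∈ P.erase m, g i ≤ y m - c := by
  induction P using Finset.strongInduction with
  | H P ih =>
    intro m hm hmax hc hg
    rcases (P.erase m).eq_empty_or_nonempty with h | h
    · rw [h, Finset.sum_empty]; linarith [hc m hm]
    · obtain ⟨n, hn, hnmax⟩ := (P.erase m).exists_max_image y h
      have hnP := Finset.mem_erase.1 hn
      have h1 := ih _ (Finset.erase_ssubset hm) n hn hnmax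
        (fun i hi => hc i (Finset.mem_of_mem_erase hi))
        (fun i hi j hj => hg i (Finset.mem_of_mem_erase hi) j (Finset.mem_of_mem_erase hj))
      have h2 := hg n hnP.2 m hm hnP.1 (hmax n hnP.2)
      rw [← Finset.add_sum_erase _ _ hn]
      linarith

/-- The pockets containing a point `z` overlap boundedly, with weights `b i / a i`. The topmost
anchor contributes at most `1`. Each of the others has height at most the vertical gap to the next
one, so their heights telescope; and since the coordinate sums increase towards the top, the total
gap is less than the smallest horizontal distance to `z`. -/
lemma sum_ratio_le_two (hs : IsAnchorSequence s) {w a b : ι → ℝ}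
    (ha : ∀ i, IsReach s i (w i) (a i))
    (hb : ∀ i, ∀ j < i, (s j).1 ≤ (s i).1 → 2 * b i ≤ (s j).2 - (s i).2)
    (hb0 : ∀ i, 0 ≤ b i) (z : ℝ × ℝ) (P : Finset ι)
    (hP : ∀ i ∈ P, 0 < a i ∧ b i ≤ a i ∧ z ∈ pocket (s i) (a i)) :
    ∑ i ∈ P, b i / a i ≤ 2 := by
  rcases P.eq_empty_or_nonempty with rfl | hne
  · simp
  obtain ⟨m, hm, hmax⟩ := P.exists_max_image (fun i => (s i).2) hne
  obtain ⟨k, hk, hmin⟩ := P.exists_min_image (fun i => (s i).2) hne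
  have pair : ∀ i ∈ P, ∀ j ∈ P, i ≠ j → (s i).2 ≤ (s j).2 → (s j).1 ≤ (s i).1 ∧ j < i :=
    fun i hi j hj hij hle => hs.lt_of_mem_pocket (ha i) (ha j) (hP i hi).1 hij hle
      (hP i hi).2.2 (hP j hj).2.2
  have hgap := sum_erase_le_of_gap (fun i => (s i).2) (fun i => 2 * b i) (s k).2 P m hm hmax hmin
    (fun i hi j hj hij hle => by
      obtain ⟨h1, h2⟩ := pair i hi j hj hij hle
      exact hb i j h2 h1)
  have hX : ∀ i ∈ P, z.1 - (s k).1 ≤ z.1 - (s i).1 := by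
    intro i hi
    rcases eq_or_ne k i with rfl | hki
    · exact le_rfl
    · linarith [(pair k hk i hi hki (hmin i hi)).1]
  obtain ⟨hak, -, hzk⟩ := hP k hk
  obtain ⟨⟨hk1, hk2⟩, hk3, hk4⟩ := mem_pocket.1 hzk
  obtain ⟨⟨hm1, hm2⟩, hm3, hm4⟩ := mem_pocket.1 (hP m hm).2.2
  have hXk : 0 < z.1 - (s k).1 := by linarith
  have hkm : (s k).1 - (s m).1 ≤ (s m).2 - (s k).2 := by
    rcases eq_or_ne k m with rfl | hkm
    · simp
    · have := hs.sum_le m k (pair k hk m hm hkm (hmin m hm)).2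
      linarith
  have hterm : ∀ i ∈ P.erase m, b i / a i ≤ 2 * b i / (z.1 - (s k).1) := by
    intro i hi
    have hiP := Finset.mem_of_mem_erase hi
    obtain ⟨hai, -, hzi⟩ := hP i hiP
    obtain ⟨⟨-, hi2⟩, -⟩ := mem_pocket.1 hzi
    rw [div_le_div_iff₀ hai hXk]
    nlinarith [hb0 i, hX i hiP]
  rw [← Finset.add_sum_erase _ _ hm]
  have hm1' : b m / a m ≤ 1 := (div_le_one (hP m hm).1).2 (hP m hm).2.1
  have hrest : ∑ i ∈ P.erase m, b i / a i ≤ 1 := by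
    refine (Finset.sum_le_sum hterm).trans ?_
    rw [← Finset.sum_div, div_le_one hXk]
    linarith
  linarith

/-- Pockets may leave the unit square, but only through its bottom side and by at most `1 / 2`. -/
lemma pocket_subset (hs : IsAnchorSequence s) {i : ι} {w a : ℝ} (h : IsReach s i w a) :
    pocket (s i) a ⊆ Set.Icc 0 1 ×ˢ Set.Icc (-(1 / 2)) 1 := by
  intro z hz
  obtain ⟨⟨h1, h2⟩, h3, h4⟩ := mem_pocket.1 hz
  obtain ⟨hi1, hi2, hi3, hi4⟩ := mem_unitSquare.1 (hs.mem i)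
  have := h.le_one
  have := h.nonneg
  have := h.two_mul_le
  exact ⟨⟨by linarith, by linarith⟩, by linarith, by linarith⟩

/-- Integrating the weighted overlap of the pockets: a pocket has area `a i * a i / 2` and weight
`b i / a i`, and the total is at most twice the area `3 / 2` of the region containing them. -/
lemma sum_mul_le_six (hs : IsAnchorSequence s) {w a b : ι → ℝ}
    (ha : ∀ i, IsReach s i (w i) (a i))
    (hb : ∀ i, ∀ j < i, (s j).1 ≤ (s i).1 → 2 * b i ≤ (s j).2 - (s i).2)
    (hb0 : ∀ i, 0 ≤ b i) (P : Finset ι) (hP : ∀ i ∈ P, 0 < a i ∧ b i ≤ a i) :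
    ∑ i ∈ P, a i * b i ≤ 6 := by
  classical
  have hnn : ∀ i ∈ P, 0 ≤ b i / a i := fun i hi => div_nonneg (hb0 i) (hP i hi).1.le
  have hmain : ∑ i ∈ P, ENNReal.ofReal (b i / a i) * volume (pocket (s i) (a i)) ≤
      ENNReal.ofReal 2 * volume (Set.Icc (0 : ℝ) 1 ×ˢ Set.Icc (-(1 / 2) : ℝ) 1) := by
    have hm : MeasurableSet (Set.Icc (0 : ℝ) 1 ×ˢ Set.Icc (-(1 / 2) : ℝ) 1) :=
      measurableSet_Icc.prod measurableSet_Icc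
    rw [← lintegral_indicator_const hm]
    simp_rw [← lintegral_indicator_const (measurableSet_pocket _ _)]
    rw [← lintegral_finsetSum _
      (fun i _ => measurable_const.indicator (measurableSet_pocket _ _))]
    refine lintegral_mono fun z => ?_
    have hz := sum_ratio_le_two hs ha hb hb0 z (P.filter fun i => z ∈ pocket (s i) (a i))
      (fun i hi => by
        obtain ⟨h1, h2⟩ := Finset.mem_filter.1 hi
        exact ⟨(hP i h1).1, (hP i h1).2, h2⟩)
    have hsum : ∑ i ∈ P, (pocket (s i) (a i)).indicator
        (fun _ => ENNReal.ofReal (b i / a i)) z =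
        ENNReal.ofReal (∑ i ∈ P.filter (fun i => z ∈ pocket (s i) (a i)), b i / a i) := by
      rw [ENNReal.ofReal_sum_of_nonneg (fun i hi => hnn i (Finset.mem_of_mem_filter i hi)),
        Finset.sum_filter]
      refine Finset.sum_congr rfl fun i _ => ?_
      simp only [Set.indicator_apply]
    simp only [hsum]
    by_cases hzb : z ∈ Set.Icc (0 : ℝ) 1 ×ˢ Set.Icc (-(1 / 2) : ℝ) 1
    · rw [Set.indicator_of_mem hzb]
      exact ENNReal.ofReal_le_ofReal hz
    · have : P.filter (fun i => z ∈ pocket (s i) (a i)) = ∅ :=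
        Finset.filter_eq_empty_iff.2 fun i _ h => hzb (pocket_subset hs (ha i) h)
      rw [this]; simp
  have hbox : volume (Set.Icc (0 : ℝ) 1 ×ˢ Set.Icc (-(1 / 2) : ℝ) 1) = ENNReal.ofReal (3 / 2) := by
    rw [Measure.volume_eq_prod, Measure.prod_prod, Real.volume_Icc, Real.volume_Icc,
      ← ENNReal.ofReal_mul (by norm_num)]
    congr 1; norm_num
  have hleft : ∑ i ∈ P, ENNReal.ofReal (b i / a i) * volume (pocket (s i) (a i)) =
      ENNReal.ofReal (∑ i ∈ P, a i * b i / 2) := by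
    rw [ENNReal.ofReal_sum_of_nonneg fun i hi =>
      div_nonneg (mul_nonneg (hP i hi).1.le (hb0 i)) zero_le_two]
    refine Finset.sum_congr rfl fun i hi => ?_
    have := (hP i hi).1
    rw [volume_pocket _ this.le, ← ENNReal.ofReal_mul (hnn i hi)]
    congr 1; field_simp
  rw [hleft, hbox, ← ENNReal.ofReal_mul zero_le_two,
    ENNReal.ofReal_le_ofReal_iff (by norm_num), ← Finset.sum_div] at hmain
  linarith

/-! ### The area estimate -/

/-- If `r i` bounds the areas of the rectangles anchored at `s i` inside its tile, then the `r i`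
have a large sum. The tiles cover the unit square, so summing `volume_tile_le` gives
`1 ≤ 12 / 128 + (2 + 9 * log 2) * ∑ i, r i`, which would even yield `0.1099`. -/
theorem le_sum_of_forall_mem_tile [Fintype ι] (hs : IsAnchorSequence s) (h0 : ∃ i, s i = 0) (r : ι → ℝ)
    (hr : ∀ i, 0 ≤ r i)
    (hrect : ∀ i, ∀ q ∈ tile s i, (q.1 - (s i).1) * (q.2 - (s i).2) ≤ r i) :
    (0.10390 : ℝ) ≤ ∑ i, r i := by
  classical
  choose w a ha using hs.exists_isReach
  choose h b hb using hs.swap.exists_isReach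
  have hab0 : ∀ i, 0 ≤ a i * b i := fun i => mul_nonneg (ha i).nonneg (hb i).nonneg
  have hwide := sum_mul_le_six hs ha (b := b)
    (fun i j hj hle => by
      have h1 := (hb i).le_of_lt j hj hle
      have h2 := (hb i).two_mul_le
      simp only [Prod.fst_swap] at h1
      linarith)
    (fun i => (hb i).nonneg) (Finset.univ.filter fun i => 0 < a i ∧ b i ≤ a i)
    (fun i hi => (Finset.mem_filter.1 hi).2)
  have htall := sum_mul_le_six hs.swap hb (b := a)
    (fun i j hj hle => by
      have h1 := (ha i).le_of_lt j hj hle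
      have h2 := (ha i).two_mul_le
      simp only [Prod.snd_swap]
      linarith)
    (fun i => (ha i).nonneg) (Finset.univ.filter fun i => 0 < b i ∧ a i ≤ b i)
    (fun i hi => (Finset.mem_filter.1 hi).2)
  have hab : ∑ i, a i * b i ≤ 12 := by
    have : ∑ i, a i * b i ≤ ∑ i, ((if 0 < a i ∧ b i ≤ a i then a i * b i else 0) +
        if 0 < b i ∧ a i ≤ b i then b i * a i else 0) := by
      refine Finset.sum_le_sum fun i _ => ?_
      have h1 := (ha i).nonneg
      have h2 := (hb i).nonneg
      have h3 := hab0 i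
      rcases h1.eq_or_lt with h1 | h1
      · rw [← h1]; simp
      rcases h2.eq_or_lt with h2 | h2
      · rw [← h2]; simp
      rcases le_total (b i) (a i) with h | h
      · rw [if_pos ⟨h1, h⟩]
        split_ifs <;> linarith
      · rw [if_pos (⟨h2, h⟩ : 0 < b i ∧ a i ≤ b i)]
        split_ifs <;> linarith
    rw [Finset.sum_add_distrib, ← Finset.sum_filter, ← Finset.sum_filter] at this
    linarith
  have hcover : unitSquare ⊆ ⋃ i, tile s i := by
    intro q hq
    have hne : (Finset.univ.filter fun i => s i ≤ q).Nonempty := by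
      obtain ⟨i, hi⟩ := h0
      refine ⟨i, Finset.mem_filter.2 ⟨Finset.mem_univ _, ?_⟩⟩
      rw [hi]; exact hq.1
    refine Set.mem_iUnion.2 ⟨Finset.min' _ hne, hq,
      (Finset.mem_filter.1 (Finset.min'_mem _ hne)).2, fun j hj hjq => ?_⟩
    exact absurd (Finset.min'_le _ j (Finset.mem_filter.2 ⟨Finset.mem_univ _, hjq⟩)) (not_le.2 hj)
  have hlog : 0 ≤ Real.log 2 := Real.log_nonneg one_le_two
  have hnn : ∀ i, 0 ≤ a i * b i / 128 + r i * (2 + 9 * Real.log 2) := fun i => by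
    have := hab0 i
    have := hr i
    positivity
  have hone : ENNReal.ofReal 1 ≤
      ENNReal.ofReal (∑ i, (a i * b i / 128 + r i * (2 + 9 * Real.log 2))) := by
    rw [ENNReal.ofReal_one, ← volume_unitSquare, ENNReal.ofReal_sum_of_nonneg fun i _ => hnn i]
    refine (measure_mono hcover).trans ((measure_iUnion_fintype_le _ _).trans ?_)
    exact Finset.sum_le_sum fun i _ => volume_tile_le hs (ha i) (hb i) (hr i) (hrect i)
  rw [ENNReal.ofReal_le_ofReal_iff (Finset.sum_nonneg fun i _ => hnn i), Finset.sum_add_distrib,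
    ← Finset.sum_div, ← Finset.sum_mul] at hone
  have hrs : 0 ≤ ∑ i, r i := Finset.sum_nonneg fun i _ => hr i
  nlinarith [Real.log_two_lt_d9]

/-! ### Rectangles and their total area -/

lemma Rect.inner_eq (r : Rect) :
    r.inner = Set.Ioo r.lowerLeft.1 r.upperRight.1 ×ˢ Set.Ioo r.lowerLeft.2 r.upperRight.2 := by
  rw [Rect.inner, Rect.carrier, ← Prod.mk.eta (p := r.lowerLeft), ← Prod.mk.eta (p := r.upperRight),
    ← Set.Icc_prod_Icc, interior_prod_eq, interior_Icc, interior_Icc]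

lemma Rect.mem_inner {r : Rect} {z : ℝ × ℝ} : z ∈ r.inner ↔
    (r.lowerLeft.1 < z.1 ∧ z.1 < r.upperRight.1) ∧
      r.lowerLeft.2 < z.2 ∧ z.2 < r.upperRight.2 := by
  rw [Rect.inner_eq]; rfl

lemma Rect.area_nonneg (r : Rect) : 0 ≤ r.area :=
  mul_nonneg (sub_nonneg.2 r.le.1) (sub_nonneg.2 r.le.2)

lemma Rect.volume_inner (r : Rect) : volume r.inner = ENNReal.ofReal r.area := by
  rw [Rect.inner_eq, Measure.volume_eq_prod, Measure.prod_prod, Real.volume_Ioo, Real.volume_Ioo,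
    ← ENNReal.ofReal_mul (sub_nonneg.2 r.le.1), Rect.area]

lemma volume_iUnion_carrier_le {R : Set Rect} (h : ∀ r ∈ R, r.carrier ⊆ unitSquare) :
    volume (⋃ r ∈ R, r.carrier) ≤ 1 :=
  (measure_mono (Set.iUnion₂_subset h)).trans volume_unitSquare.le

lemma totalArea_le_one {R : Set Rect} (h : ∀ r ∈ R, r.carrier ⊆ unitSquare) :
    totalArea R ≤ 1 :=
  ENNReal.toReal_le_of_le_ofReal zero_le_one (by simpa using volume_iUnion_carrier_le h)

lemma sum_area_le_totalArea {ι : Type*} [Fintype ι] (g : ι → Rect) {R : Set Rect}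
    (hR : ∀ r ∈ R, r.carrier ⊆ unitSquare) (hg : ∀ i, g i ∈ R)
    (hdisj : Pairwise fun i j => Disjoint (g i).inner (g j).inner) :
    ∑ i, (g i).area ≤ totalArea R := by
  have hfin : volume (⋃ r ∈ R, r.carrier) ≠ ⊤ :=
    ((volume_iUnion_carrier_le hR).trans_lt ENNReal.one_lt_top).ne
  rw [totalArea, ← ENNReal.ofReal_le_iff_le_toReal hfin,
    ENNReal.ofReal_sum_of_nonneg fun i _ => (g i).area_nonneg]
  simp_rw [← Rect.volume_inner]
  rw [← tsum_fintype (L := .unconditional _),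
    ← measure_iUnion hdisj fun i => isOpen_interior.measurableSet]
  refine measure_mono (Set.iUnion_subset fun i => ?_)
  exact interior_subset.trans (Set.subset_biUnion_of_mem (u := Rect.carrier) (hg i))

/-! ### Runs of the algorithm -/

/-- The upper-right corners of the candidates form a compact set, so one of maximum area exists. -/
lemma exists_isGreedyChoice (S : Finset (ℝ × ℝ)) (R : Set Rect) {p : ℝ × ℝ}
    (hp : p ∈ unitSquare) : ∃ r, IsGreedyChoice S R p r := by
  let A : Set (ℝ × ℝ) := (⋃ r ∈ R, r.inner) ∪ S
  -- The corners `c` for which the open rectangle from `p` to `c` misses `A`.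
  let C : Set (ℝ × ℝ) := {c | ∀ z ∈ A, p.1 < z.1 → p.2 < z.2 → c.1 ≤ z.1 ∨ c.2 ≤ z.2}
  have hC : IsClosed C := by
    simp only [C, Set.ofPred_forall]
    refine isClosed_iInter fun z => isClosed_iInter fun _ => isClosed_iInter fun _ =>
      isClosed_iInter fun _ => ?_
    have h1 : IsClosed {c : ℝ × ℝ | c.1 ≤ z.1} := isClosed_le (by fun_prop) (by fun_prop)
    have h2 : IsClosed {c : ℝ × ℝ | c.2 ≤ z.2} := isClosed_le (by fun_prop) (by fun_prop)
    exact h1.union h2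
  have hcomp : IsCompact (Set.Icc p (1, 1) ∩ C) := isCompact_Icc.inter_right hC
  have hcand : ∀ r : Rect, IsCandidate S R p r ↔
      r.lowerLeft = p ∧ r.upperRight ∈ Set.Icc p (1, 1) ∩ C := by
    intro r
    constructor
    · rintro ⟨rfl, h2, h3, h4⟩
      refine ⟨rfl, ⟨r.le, (h2 (Set.right_mem_Icc.2 r.le)).2⟩, fun z hz hz1 hz2 => ?_⟩
      by_contra! hcon
      have hzr : z ∈ r.inner := Rect.mem_inner.2 ⟨⟨hz1, hcon.1⟩, hz2, hcon.2⟩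
      rcases hz with hz | hz
      · obtain ⟨r', hr', hz'⟩ := Set.mem_iUnion₂.1 hz
        exact Set.disjoint_left.1 (h3 r' hr') hzr hz'
      · exact h4 z hz hzr
    · rintro ⟨rfl, ⟨-, h2⟩, h3⟩
      have hA : ∀ z ∈ A, z ∉ r.inner := by
        intro z hz hzr
        obtain ⟨⟨a1, a2⟩, a3, a4⟩ := Rect.mem_inner.1 hzr
        rcases h3 z hz a1 a3 with h | h <;> linarith
      refine ⟨rfl, Set.Icc_subset_Icc hp.1 h2, fun r' hr' => ?_, fun s hs => hA s (Or.inr hs)⟩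
      exact Set.disjoint_left.2 fun z hz hz' =>
        hA z (Or.inl (Set.mem_biUnion hr' hz')) hz
  obtain ⟨c, hc, hmax⟩ := hcomp.exists_isMaxOn (f := fun c => (c.1 - p.1) * (c.2 - p.2))
    ⟨p, ⟨le_rfl, hp.2⟩, fun z _ h _ => Or.inl h.le⟩ (by fun_prop)
  refine ⟨⟨p, c, hc.1.1⟩, (hcand _).2 ⟨rfl, hc⟩, fun r' hr' => ?_⟩
  obtain ⟨h1, h2⟩ := (hcand r').1 hr'
  have := hmax h2
  simpa [Rect.area, h1] using this

lemma exists_greedyRun (S : Finset (ℝ × ℝ)) (l : List (ℝ × ℝ)) (hl : ∀ p ∈ l, p ∈ unitSquare) :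
    ∃ R, GreedyRun S l R := by
  induction l using List.reverseRecOn with
  | nil => exact ⟨∅, .nil⟩
  | append_singleton l p ih =>
    obtain ⟨R, hR⟩ := ih fun q hq => hl q (by simp [hq])
    obtain ⟨r, hr⟩ := exists_isGreedyChoice S R (hl p (by simp))
    exact ⟨_, .step hR hr⟩

/-- `g p` is the rectangle that a run through the list `l` has placed at `p`. The last field says
that it is at least as large as every rectangle with lower-left corner `p` whose upper-right corner
`q` lies in the tile of `p`. -/
structure IsGreedyAssignment (S : Finset (ℝ × ℝ)) (l : List (ℝ × ℝ)) (g : ℝ × ℝ → Rect) :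
    Prop where
  lowerLeft_eq : ∀ p ∈ l, (g p).lowerLeft = p
  subset_unitSquare : ∀ p ∈ l, (g p).carrier ⊆ unitSquare
  empty : ∀ p ∈ l, ∀ s ∈ S, s ∉ (g p).inner
  interior_disjoint : ∀ p ∈ l, ∀ q ∈ l, p ≠ q → Disjoint (g p).inner (g q).inner
  area_ge : ∀ l₁ p l₂, l = l₁ ++ p :: l₂ → ∀ q ∈ unitSquare, p ≤ q → (∀ s ∈ l₁, ¬ s ≤ q) →
    (q.1 - p.1) * (q.2 - p.2) ≤ (g p).area

/-- For a corner `q` in the tile of `p`, the rectangle from `p` to `q` is a candidate: every earlier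
rectangle, and every point of `S` that could lie in its interior, belongs to the quadrant of an
earlier anchor, and such a quadrant does not contain `q`. -/
lemma GreedyRun.exists_assignment {S : Finset (ℝ × ℝ)} {l : List (ℝ × ℝ)} {R : Set Rect}
    (h : GreedyRun S l R) (hnd : l.Nodup) (hU : ∀ p ∈ l, p ∈ unitSquare)
    (hS : ∀ l₁ p l₂, l = l₁ ++ p :: l₂ → ∀ s ∈ S, p.1 < s.1 → p.2 < s.2 → s ∈ l₁) :
    ∃ g, R = g '' {p | p ∈ l} ∧ IsGreedyAssignment S l g := by
  classical
  induction h with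
  | nil =>
    refine ⟨fun p => ⟨p, p, le_rfl⟩, by simp, ?_⟩
    constructor <;> simp
  | @step l R p r hrun hch ih =>
    obtain ⟨hnd', -, hpl⟩ := List.nodup_append.1 hnd
    have hpl : p ∉ l := fun h => hpl p h p (by simp) rfl
    obtain ⟨g, rfl, hg⟩ := ih hnd' (fun q hq => hU q (by simp [hq]))
      (fun l₁ q l₂ he => hS l₁ q (l₂ ++ [p]) (by simp [he]))
    obtain ⟨hcand, hmax⟩ := hch
    have hne : ∀ q ∈ l, q ≠ p := fun q hq h => hpl (h ▸ hq)
    have hold : ∀ q ∈ l, Function.update g p r q = g q := fun q hq =>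
      Function.update_of_ne (hne q hq) _ _
    have hnew : Function.update g p r p = r := Function.update_self _ _ _
    have hmem : ∀ q, q ∈ l ++ [p] ↔ q ∈ l ∨ q = p := by simp
    refine ⟨Function.update g p r, ?_, ?_, ?_, ?_, ?_, ?_⟩
    · ext x
      simp only [Set.mem_insert_iff, Set.mem_image, Set.mem_ofPred_eq, hmem]
      constructor
      · rintro (rfl | ⟨q, hq, rfl⟩)
        · exact ⟨p, Or.inr rfl, hnew⟩
        · exact ⟨q, Or.inl hq, hold q hq⟩
      · rintro ⟨q, hq | rfl, rfl⟩
        · exact Or.inr ⟨q, hq, (hold q hq).symm⟩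
        · exact Or.inl hnew
    · intro q hq
      rcases (hmem q).1 hq with hq | rfl
      · rw [hold q hq]; exact hg.lowerLeft_eq q hq
      · rw [hnew]; exact hcand.lowerLeft_eq
    · intro q hq
      rcases (hmem q).1 hq with hq | rfl
      · rw [hold q hq]; exact hg.subset_unitSquare q hq
      · rw [hnew]; exact hcand.subset_unitSquare
    · intro q hq
      rcases (hmem q).1 hq with hq | rfl
      · rw [hold q hq]; exact hg.empty q hq
      · rw [hnew]; exact hcand.empty
    · intro q hq q' hq' hqq'
      rcases (hmem q).1 hq with hql | rfl <;> rcases (hmem q').1 hq' with hql' | rfl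
      · rw [hold q hql, hold q' hql']; exact hg.interior_disjoint q hql q' hql' hqq'
      · rw [hold q hql, hnew]
        exact (hcand.interior_disjoint _ (Set.mem_image_of_mem g hql)).symm
      · rw [hold q' hql', hnew]
        exact hcand.interior_disjoint _ (Set.mem_image_of_mem g hql')
      · exact absurd rfl hqq'
    · intro l₁ p' l₂ he q hqU hpq hq
      rcases List.eq_nil_or_concat l₂ with rfl | ⟨l₃, p'', rfl⟩
      · obtain ⟨rfl, hp'⟩ := List.append_inj' he rfl
        obtain rfl : p = p' := by simpa using hp'
        rw [hnew]
        refine hmax ⟨p, q, hpq⟩ ⟨rfl, Set.Icc_subset_Icc (hU p (by simp)).1 hqU.2, ?_, ?_⟩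
        · rintro _ ⟨p₁, hp₁, rfl⟩
          refine Set.disjoint_left.2 fun z hz hz' => hq p₁ hp₁ ?_
          have h1 := Rect.mem_inner.1 hz
          have h2 := Rect.mem_inner.1 hz'
          rw [hg.lowerLeft_eq p₁ hp₁] at h2
          exact ⟨(h2.1.1.trans h1.1.2).le, (h2.2.1.trans h1.2.2).le⟩
        · intro s hs hsr
          have h1 := Rect.mem_inner.1 hsr
          exact hq s (hS l p [] rfl s hs h1.1.1 h1.2.1) ⟨h1.1.2.le, h1.2.2.le⟩
      · have he' : l ++ [p] = (l₁ ++ p' :: l₃) ++ [p''] := by simpa using he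
        obtain ⟨hl, -⟩ := List.append_inj' he' rfl
        rw [hold p' (by simp [hl])]
        exact hg.area_ge l₁ p' l₃ hl q hqU hpq hq

lemma IsProcessingOrder.isAnchorSequence {S : Finset (ℝ × ℝ)} {l : List (ℝ × ℝ)}
    (hl : IsProcessingOrder S l) (hS : ∀ p ∈ S, p ∈ unitSquare) :
    IsAnchorSequence fun i : Fin l.length => l[i] where
  injective := fun _ _ h => Fin.ext ((List.Nodup.getElem_inj_iff hl.nodup).1 h)
  mem := fun _ => hS _ ((hl.mem_iff _).1 (List.getElem_mem _))
  sum_le := fun i j h => List.pairwise_iff_getElem.1 hl.sorted i j i.2 j.2 h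

lemma GreedyRun.isLLARP_and_le {S : Finset (ℝ × ℝ)} (hS : IsInstance S) {l : List (ℝ × ℝ)}
    (hl : IsProcessingOrder S l) {R : Set Rect} (hR : GreedyRun S l R) :
    IsLLARP S R ∧ (0.10390 : ℝ) ≤ totalArea R := by
  have hearlier : ∀ l₁ p l₂, l = l₁ ++ p :: l₂ → ∀ s ∈ S, p.1 < s.1 → p.2 < s.2 → s ∈ l₁ := by
    intro l₁ p l₂ he s hs h1 h2
    have hsl := (hl.mem_iff s).2 hs
    have hsort := hl.sorted
    rw [he] at hsl hsort
    rcases List.mem_append.1 hsl with h | h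
    · exact h
    rcases List.mem_cons.1 h with rfl | h
    · exact absurd h1 (lt_irrefl _)
    · have := (List.pairwise_cons.1 (List.pairwise_append.1 hsort).2.1).1 s h
      linarith
  obtain ⟨g, rfl, hg⟩ := hR.exists_assignment hl.nodup
    (fun p hp => hS.1 p ((hl.mem_iff p).1 hp)) hearlier
  have hsub : ∀ r ∈ g '' {p | p ∈ l}, r.carrier ⊆ unitSquare := by
    rintro _ ⟨p, hp, rfl⟩
    exact hg.subset_unitSquare p hp
  refine ⟨⟨hsub, ?_, ?_, ?_, ?_⟩, ?_⟩
  · rintro _ ⟨p, hp, rfl⟩ _ ⟨q, hq, rfl⟩ hne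
    exact hg.interior_disjoint p hp q hq fun h => hne (h ▸ rfl)
  · rintro _ ⟨p, hp, rfl⟩
    rw [hg.lowerLeft_eq p hp]
    exact (hl.mem_iff p).1 hp
  · rintro _ ⟨p, hp, rfl⟩
    exact hg.empty p hp
  · intro p hp
    have hp := (hl.mem_iff p).2 hp
    refine ⟨g p, ⟨Set.mem_image_of_mem g hp, hg.lowerLeft_eq p hp⟩, ?_⟩
    rintro _ ⟨⟨q, hq, rfl⟩, hqp⟩
    rw [← hqp, hg.lowerLeft_eq q hq]
  · have hanchor := hl.isAnchorSequence hS.1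
    refine (le_sum_of_forall_mem_tile hanchor ?_ (fun i => (g l[i]).area)
      (fun i => Rect.area_nonneg _) ?_).trans
      (sum_area_le_totalArea (fun i : Fin l.length => g l[i]) hsub
        (fun i => Set.mem_image_of_mem g (List.getElem_mem _)) ?_)
    · obtain ⟨i, hi, h⟩ := List.getElem_of_mem ((hl.mem_iff _).2 hS.2)
      exact ⟨⟨i, hi⟩, h⟩
    · rintro i q ⟨hqU, hiq, hq⟩
      refine hg.area_ge (l.take i) l[i] (l.drop (i + 1)) ?_ q hqU hiq fun s hs => ?_
      · simp
      · obtain ⟨j, hj, rfl⟩ := List.mem_take_iff_getElem.1 hs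
        exact hq ⟨j, by omega⟩ (Fin.mk_lt_of_lt_val (by omega))
    · intro i j hij
      exact hg.interior_disjoint _ (List.getElem_mem _) _ (List.getElem_mem _)
        (hanchor.injective.ne hij)

lemma exists_isProcessingOrder (S : Finset (ℝ × ℝ)) : ∃ l, IsProcessingOrder S l := by
  let le : ℝ × ℝ → ℝ × ℝ → Prop := fun p q => q.1 + q.2 ≤ p.1 + p.2
  have : Std.Total le := ⟨fun p q => le_total _ _⟩
  have : IsTrans _ le := ⟨fun _ _ _ h1 h2 => le_trans h2 h1⟩
  classical
  have hperm := List.perm_insertionSort le S.toList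
  exact ⟨S.toList.insertionSort le, hperm.nodup_iff.2 S.nodup_toList,
    fun p => by rw [hperm.mem_iff, Finset.mem_toList], List.pairwise_insertionSort le _⟩

/-! ### The approximation ratio -/

lemma le_totalArea_div_optimalArea {S : Finset (ℝ × ℝ)} {R : Set Rect} (hR : IsLLARP S R)
    {c : ℝ} (hc : 0 < c) (hcR : c ≤ totalArea R) : c ≤ totalArea R / optimalArea S := by
  have hub : ∀ A ∈ {A : ℝ | ∃ R : Set Rect, IsLLARP S R ∧ A = totalArea R}, A ≤ 1 := by
    rintro _ ⟨R, hR, rfl⟩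
    exact totalArea_le_one hR.subset_unitSquare
  have h1 : optimalArea S ≤ 1 := csSup_le ⟨_, R, hR, rfl⟩ hub
  have h2 : totalArea R ≤ optimalArea S := le_csSup ⟨1, hub⟩ ⟨R, hR, rfl⟩
  rw [le_div_iff₀ (by linarith)]
  nlinarith

end AnchoredPacking

theorem theorem1 :
    (∀ S : Finset (ℝ × ℝ), AnchoredPacking.IsInstance S →
      -- every run of the algorithm, in every admissible order
      (∀ l : List (ℝ × ℝ), AnchoredPacking.IsProcessingOrder S l →
        (∃ R : Set AnchoredPacking.Rect, AnchoredPacking.GreedyRun S l R) ∧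
        ∀ R : Set AnchoredPacking.Rect, AnchoredPacking.GreedyRun S l R →
          AnchoredPacking.IsLLARP S R ∧ (0.10390 : ℝ) ≤ AnchoredPacking.totalArea R) ∧
      -- in particular, the lower bound for Freedman's problem
      (∃ R : Set AnchoredPacking.Rect,
        AnchoredPacking.IsLLARP S R ∧ (0.10390 : ℝ) ≤ AnchoredPacking.totalArea R)) ∧
    -- the approximation ratio
    (0.10390 : ℝ) ≤ AnchoredPacking.greedyApproximationRatio := by
  open AnchoredPacking in
  have hrun : ∀ S, IsInstance S → ∀ l, IsProcessingOrder S l → ∃ R, GreedyRun S l R :=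
    fun S hS l hl => exists_greedyRun S l fun p hp => hS.1 p ((hl.mem_iff p).1 hp)
  refine ⟨fun S hS => ⟨fun l hl => ⟨hrun S hS l hl, fun R hR => hR.isLLARP_and_le hS hl⟩, ?_⟩, ?_⟩
  · obtain ⟨l, hl⟩ := AnchoredPacking.exists_isProcessingOrder S
    obtain ⟨R, hR⟩ := hrun S hS l hl
    exact ⟨R, hR.isLLARP_and_le hS hl⟩
  · refine le_csInf ?_ ?_
    · have hS : AnchoredPacking.IsInstance {(0, 0)} := by
        simp [AnchoredPacking.IsInstance, AnchoredPacking.mem_unitSquare]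
      obtain ⟨l, hl⟩ := AnchoredPacking.exists_isProcessingOrder {(0, 0)}
      obtain ⟨R, hR⟩ := hrun _ hS l hl
      exact ⟨_, _, l, R, hS, hl, hR, rfl⟩
    · rintro _ ⟨S, l, R, hS, hl, hR, rfl⟩
      obtain ⟨h1, h2⟩ := hR.isLLARP_and_le hS hl
      exact AnchoredPacking.le_totalArea_div_optimalArea h1 (by norm_num) h2
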